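/- For sets $X, S \subseteq \omega$ of natural numbers, call $S$ $\Sigma^0_0(X)$ if $S$ is computable in (Turing reducible to) $X$, and $\Sigma^0_{n+1}(X)$ if there is a set $R$ such that $R$ is $\Sigma^0_n(X)$ and $S = \{x : (\exists y)\ \langle x, y\rangle \notin R\}$, where $\langle\cdot,\cdot\rangle$ is a computable pairing function. A set is \emph{arithmetical in} $X$ if it is $\Sigma^0_n(X)$ for some $n \in \omega$ (equivalently, if it is computable in the $n$-th Turing jump $X^{(n)}$ for some $n$), and it is \emph{arithmetical} if it is arithmetical in $\emptyset$. \textbf{Theorem.} Let $B \subseteq \omega$ be a set which is not arithmetical. Then for every set $A \subseteq \omega$ there is an infinite set $H$ with $H \subseteq A$ or $H \subseteq \omega \setminus A$ such that $B$ is not arithmetical in $H$. -/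

import Mathlib

open Classical in
/-- The characteristic function of a set `X` of natural numbers, as a (total) partial function,
so that it can serve as an oracle. -/
noncomputable def charFun (X : Set ℕ) : ℕ →. ℕ :=
  fun n => Part.some (if n ∈ X then 1 else 0)

/-- `S` is computable in `X` (`S ≤_T X`), for sets of natural numbers. -/
def SetComputableIn (X S : Set ℕ) : Prop :=
  TuringReducible (charFun S) (charFun X)

/-- The arithmetical hierarchy relative to `X`: `SigmaZero X n S` says that `S` is `Σ⁰ₙ(X)`.
The `Σ⁰₀(X)` sets are the `X`-computable ones, and `S` is `Σ⁰ₙ₊₁(X)` when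
`x ∈ S ↔ ∃ y, ⟨x, y⟩ ∈ Rᶜ` for some `Σ⁰ₙ(X)` set `R` (so that `Rᶜ` is `Π⁰ₙ(X)`). -/
def SigmaZero (X : Set ℕ) : ℕ → Set ℕ → Prop
  | 0, S => SetComputableIn X S
  | n + 1, S => ∃ R : Set ℕ, SigmaZero X n R ∧ ∀ x, x ∈ S ↔ ∃ y, Nat.pair x y ∉ R

/-- `B` is arithmetical in `X` if it belongs to some level of the arithmetical hierarchy
relative to `X`. -/
def ArithmeticalIn (X B : Set ℕ) : Prop :=
  ∃ n, SigmaZero X n B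

/-- `B` is arithmetical if it is arithmetical in the empty set. -/
def Arithmetical (B : Set ℕ) : Prop :=
  ArithmeticalIn ∅ B

-- An ultrafilter `p` of infinite sets is fixed in advance. Mathias forcing with reservoirs in `p`
-- then starts from whichever of `A`, `Aᶜ` belongs to `p`. Each level of the hierarchy gets a
-- forcing `question` about a stem, in which "some extension" is read as "inside every member of
-- `p`, some extension". Whatever the answer, an extension of the condition forces it
-- (`exists_forces`). If the answers at a given stem form an arithmetical set, they differ from the
-- non-arithmetical `B` at some `x`; forcing the answer at `x` separates `B` from the corresponding
-- set arithmetical in the generic (`exists_diagonal`, `truth`).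
--
-- The main work is to make every question arithmetical, although `p` itself need not be definable.
-- A question at a successor level asks whether every member of `p` has a finite subset satisfying a
-- monotone predicate `V` (`Within`). By compactness, some ultrafilter has this property exactly
-- when no finite colouring avoids monochromatic sets in `V` (`Large`), which is an arithmetical
-- condition. A greedy choice therefore decides a whole sequence of such questions, with
-- arithmetical answers, on a nonempty closed set of ultrafilters (`UltraStage.exists_decide`).
-- Iterating over the levels and the countably many pairs `u`, `W` gives a decreasing sequence of
-- closed sets, and `p` is any common point.

attribute [fun_prop] Primrec

/-! ### Automation for primitive recursive functions. -/

namespace Primrec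

variable {α β γ : Type*} [Primcodable α] [Primcodable β] [Primcodable γ]

@[fun_prop]
theorem fun_id : Primrec fun a : α => a := .id

@[fun_prop]
theorem fun_const (b : β) : Primrec fun _ : α => b := .const b

@[fun_prop]
theorem fun_comp {f : β → γ} {g : α → β} (hf : Primrec f) (hg : Primrec g) :
    Primrec fun a => f (g a) := hf.comp hg

@[fun_prop]
theorem fun_pair {f : α → β} {g : α → γ} (hf : Primrec f) (hg : Primrec g) :
    Primrec fun a => (f a, g a) := hf.pair hg

@[fun_prop]
theorem fun_fst {f : α → β × γ} (hf : Primrec f) : Primrec fun a => (f a).1 := Primrec.fst.comp hf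

@[fun_prop]
theorem fun_snd {f : α → β × γ} (hf : Primrec f) : Primrec fun a => (f a).2 := Primrec.snd.comp hf

@[fun_prop]
theorem fun_succ {f : α → ℕ} (hf : Primrec f) : Primrec fun a => (f a).succ :=
  Primrec.succ.comp hf

@[fun_prop]
theorem fun_add {f g : α → ℕ} (hf : Primrec f) (hg : Primrec g) : Primrec fun a => f a + g a :=
  nat_add.comp hf hg

@[fun_prop]
theorem fun_mul {f g : α → ℕ} (hf : Primrec f) (hg : Primrec g) : Primrec fun a => f a * g a :=
  nat_mul.comp hf hg

@[fun_prop]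
theorem fun_mod {f g : α → ℕ} (hf : Primrec f) (hg : Primrec g) : Primrec fun a => f a % g a :=
  nat_mod.comp hf hg

@[fun_prop]
theorem fun_div {f g : α → ℕ} (hf : Primrec f) (hg : Primrec g) : Primrec fun a => f a / g a :=
  nat_div.comp hf hg

@[fun_prop]
theorem fun_max {f g : α → ℕ} (hf : Primrec f) (hg : Primrec g) :
    Primrec fun a => max (f a) (g a) :=
  nat_max.comp hf hg

@[fun_prop]
theorem fun_pow {f g : α → ℕ} (hf : Primrec f) (hg : Primrec g) : Primrec fun a => f a ^ g a :=
  Primrec₂.comp (f := fun a b : ℕ => a ^ b) (Primrec₂.unpaired'.1 Nat.Primrec.pow) hf hg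

@[fun_prop]
theorem fun_natPair {f g : α → ℕ} (hf : Primrec f) (hg : Primrec g) :
    Primrec fun a => Nat.pair (f a) (g a) :=
  Primrec₂.natPair.comp hf hg

@[fun_prop]
theorem fun_unpair {f : α → ℕ} (hf : Primrec f) : Primrec fun a => Nat.unpair (f a) :=
  Primrec.unpair.comp hf

@[fun_prop]
theorem fun_beta {f g : α → ℕ} (hf : Primrec f) (hg : Primrec g) :
    Primrec fun a => Nat.beta (f a) (g a) := by
  unfold Nat.beta
  fun_prop

end Primrec

theorem PrimrecPred.testBit {α : Type*} [Primcodable α] {f g : α → ℕ} (hf : Primrec f)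
    (hg : Primrec g) : PrimrecPred fun a => (f a).testBit (g a) = true := by
  have h : PrimrecPred fun a => f a / 2 ^ g a % 2 = 1 :=
    Primrec.eq.comp (by fun_prop) (Primrec.const 1)
  exact h.of_eq fun a => by simp [Nat.testBit_eq_decide_div_mod_eq]

/-! ### Finite sets coded by binary digits. -/

open Classical in
/-- The number whose binary digits code the set `G ∩ [0, m)`. -/
noncomputable def seg (G : Set ℕ) (m : ℕ) : ℕ :=
  m.rec 0 fun i s => if i ∈ G then s + 2 ^ i else s

/-- The finite set of natural numbers coded by the binary digits of `a`. -/
def bits (a : ℕ) : Set ℕ := {i | a.testBit i = true}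

theorem seg_zero (G : Set ℕ) : seg G 0 = 0 := rfl

theorem seg_succ_of_mem {G : Set ℕ} {m : ℕ} (h : m ∈ G) : seg G (m + 1) = seg G m + 2 ^ m := by
  simp [seg, h]

theorem seg_succ_of_notMem {G : Set ℕ} {m : ℕ} (h : m ∉ G) : seg G (m + 1) = seg G m := by
  simp [seg, h]

theorem seg_lt (G : Set ℕ) (m : ℕ) : seg G m < 2 ^ m := by
  induction m with
  | zero => simp [seg_zero]
  | succ m ih =>
    by_cases h : m ∈ G
    · rw [seg_succ_of_mem h, pow_succ]; omega
    · rw [seg_succ_of_notMem h, pow_succ]; omega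

theorem testBit_seg (G : Set ℕ) (m i : ℕ) : (seg G m).testBit i = true ↔ i < m ∧ i ∈ G := by
  induction m with
  | zero => simp [seg_zero]
  | succ m ih =>
    by_cases h : m ∈ G
    · rw [seg_succ_of_mem h, add_comm]
      rcases lt_trichotomy i m with hi | rfl | hi
      · rw [Nat.testBit_two_pow_add_gt hi, ih]; simp [hi, hi.trans (Nat.lt_succ_self m)]
      · rw [Nat.testBit_two_pow_add_eq, Nat.testBit_lt_two_pow (seg_lt G i)]; simp [h]
      · have : 2 ^ m + seg G m < 2 ^ i :=
          lt_of_lt_of_le (by have := seg_lt G m; rw [pow_succ]; omega)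
            (Nat.pow_le_pow_right two_pos hi)
        rw [Nat.testBit_lt_two_pow this]; simp; omega
    · rw [seg_succ_of_notMem h, ih]
      constructor
      · rintro ⟨h1, h2⟩; exact ⟨by omega, h2⟩
      · rintro ⟨h1, h2⟩
        exact ⟨lt_of_le_of_ne (Nat.lt_succ_iff.1 h1) fun e => h (e ▸ h2), h2⟩

theorem mem_bits {a i : ℕ} : i ∈ bits a ↔ a.testBit i = true := Iff.rfl

theorem bits_injective : Function.Injective bits := fun a b h =>
  Nat.eq_of_testBit_eq fun i => by
    have := Set.ext_iff.1 h i
    rwa [mem_bits, mem_bits, ← Bool.eq_iff_iff] at this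

theorem bits_seg (G : Set ℕ) (m : ℕ) : bits (seg G m) = {i | i < m ∧ i ∈ G} :=
  Set.ext fun i => testBit_seg G m i

theorem bits_mod (a m : ℕ) : bits (a % 2 ^ m) = {i | i < m ∧ i ∈ bits a} := by
  ext i; simp [mem_bits, Nat.testBit_mod_two_pow]

theorem seg_bits (a m : ℕ) : seg (bits a) m = a % 2 ^ m :=
  bits_injective (by rw [bits_seg, bits_mod])

theorem seg_mod (G : Set ℕ) (m k : ℕ) (h : k ≤ m) : seg G m % 2 ^ k = seg G k :=
  bits_injective (by
    rw [bits_mod, bits_seg, bits_seg]; ext i; simp only [Set.mem_ofPred_eq]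
    exact ⟨fun h => ⟨h.1, h.2.2⟩, fun h' => ⟨h'.1, by omega, h'.2⟩⟩)

theorem seg_congr {G H : Set ℕ} {m : ℕ} (h : ∀ i < m, i ∈ G ↔ i ∈ H) : seg G m = seg H m :=
  bits_injective (by
    rw [bits_seg, bits_seg]; ext i; simp only [Set.mem_ofPred_eq]
    exact and_congr_right (h i))



theorem lt_of_mem_bits {a i : ℕ} (h : i ∈ bits a) : i < a := by
  by_contra hi
  have : a < 2 ^ i := lt_of_le_of_lt (not_lt.1 hi) Nat.lt_two_pow_self
  rw [mem_bits, Nat.testBit_lt_two_pow this] at h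
  exact absurd h (by simp)

theorem exists_bits_eq {s : Set ℕ} (h : s.Finite) : ∃ a, bits a = s := by
  obtain ⟨m, hm⟩ := h.bddAbove
  exact ⟨seg s (m + 1), by
    rw [bits_seg]; ext i; simp only [Set.mem_ofPred_eq, and_iff_right_iff_imp]
    exact fun hi => Nat.lt_succ_of_le (hm hi)⟩

theorem bits_finite (a : ℕ) : (bits a).Finite :=
  (Set.finite_lt_nat a).subset fun _ hi => lt_of_mem_bits hi

/-! ### Arithmetical definability over primitive recursive queries. -/

/-- The projection of the complement of `S`, the operation which raises the level in the
arithmetical hierarchy. -/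
def coproj (S : Set ℕ) : Set ℕ := {x | ∃ y, Nat.pair x y ∉ S}

theorem coproj_preimage_fst (S : Set ℕ) : coproj {n | n.unpair.1 ∈ S} = Sᶜ := by
  ext x; simp [coproj]

/-- The sets which can be decided from `G` by a primitive recursive procedure that queries an
initial segment of `G` of primitive recursive length. -/
def PrimQuery (u : ℕ → ℕ) (W : Set ℕ) (G : Set ℕ) : Set ℕ := {x | Nat.pair x (seg G (u x)) ∈ W}

/-- The level `n` of the arithmetical hierarchy over primitive recursive queries to `G`. -/
def ArithLevel (G : Set ℕ) (n : ℕ) (S : Set ℕ) : Prop :=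
  ∃ u W, Primrec u ∧ PrimrecPred (· ∈ W) ∧ S = coproj^[n] (PrimQuery u W G)

namespace ArithLevel

variable {G S S' : Set ℕ} {n : ℕ}

theorem succ_iff : ArithLevel G (n + 1) S ↔ ∃ R, ArithLevel G n R ∧ S = coproj R := by
  constructor
  · rintro ⟨u, W, hu, hW, rfl⟩
    exact ⟨_, ⟨u, W, hu, hW, rfl⟩, Function.iterate_succ_apply' _ _ _⟩
  · rintro ⟨_, ⟨u, W, hu, hW, rfl⟩, rfl⟩
    exact ⟨u, W, hu, hW, (Function.iterate_succ_apply' _ _ _).symm⟩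

theorem preimage {f : ℕ → ℕ} (hf : Primrec f) (h : ArithLevel G n S) :
    ArithLevel G n (f ⁻¹' S) := by
  induction n generalizing f S with
  | zero =>
    obtain ⟨u, W, hu, hW, rfl⟩ := h
    refine ⟨fun x => u (f x), {n : ℕ | Nat.pair (f n.unpair.1) n.unpair.2 ∈ W}, by fun_prop,
      hW.comp (f := fun n : ℕ => Nat.pair (f n.unpair.1) n.unpair.2) (by fun_prop), ?_⟩
    ext x; simp [PrimQuery]
  | succ n ih =>
    obtain ⟨R, hR, rfl⟩ := succ_iff.1 h
    refine succ_iff.2 ⟨_, ih (f := fun n : ℕ => Nat.pair (f n.unpair.1) n.unpair.2)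
      (by fun_prop) hR, ?_⟩
    ext x; simp [coproj]

theorem compl_zero (h : ArithLevel G 0 S) : ArithLevel G 0 Sᶜ := by
  obtain ⟨u, W, hu, hW, rfl⟩ := h
  exact ⟨u, Wᶜ, hu, hW.not, rfl⟩

/-- A dummy second coordinate turns projection of the complement into complementation. -/
theorem compl (h : ArithLevel G n S) : ArithLevel G (n + 1) Sᶜ :=
  succ_iff.2 ⟨_, h.preimage (f := fun n : ℕ => n.unpair.1) (by fun_prop),
    (coproj_preimage_fst S).symm⟩

theorem succ (h : ArithLevel G n S) : ArithLevel G (n + 1) S := by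
  induction n generalizing S with
  | zero => simpa using h.compl_zero.compl
  | succ n ih =>
    obtain ⟨R, hR, rfl⟩ := succ_iff.1 h
    exact succ_iff.2 ⟨R, ih hR, rfl⟩

theorem mono {m : ℕ} (hnm : n ≤ m) (h : ArithLevel G n S) : ArithLevel G m S := by
  induction hnm with
  | refl => exact h
  | step _ ih => exact ih.succ

theorem inter_zero (h : ArithLevel G 0 S) (h' : ArithLevel G 0 S') :
    ArithLevel G 0 (S ∩ S') := by
  obtain ⟨u, W, hu, hW, rfl⟩ := h
  obtain ⟨u', W', hu', hW', rfl⟩ := h'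
  -- One segment of the larger length answers both queries; reduction modulo a power of two recovers
  -- each shorter segment.
  refine ⟨fun x => max (u x) (u' x),
    {n : ℕ | Nat.pair n.unpair.1 (n.unpair.2 % 2 ^ u n.unpair.1) ∈ W ∧
      Nat.pair n.unpair.1 (n.unpair.2 % 2 ^ u' n.unpair.1) ∈ W'}, by fun_prop, ?_, ?_⟩
  · exact (hW.comp (f := fun n : ℕ => Nat.pair n.unpair.1 (n.unpair.2 % 2 ^ u n.unpair.1))
      (by fun_prop)).and
      (hW'.comp (f := fun n : ℕ => Nat.pair n.unpair.1 (n.unpair.2 % 2 ^ u' n.unpair.1))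
        (by fun_prop))
  · ext x
    simp [PrimQuery, seg_mod]

/-- `coproj` negates, so an intersection at one level needs a union one level below and conversely:
the two are proved together. -/
theorem inter_union (h : ArithLevel G n S) (h' : ArithLevel G n S') :
    ArithLevel G n (S ∩ S') ∧ ArithLevel G n (S ∪ S') := by
  induction n generalizing S S' with
  | zero =>
    refine ⟨h.inter_zero h', ?_⟩
    simpa [Set.compl_inter] using (h.compl_zero.inter_zero h'.compl_zero).compl_zero
  | succ n ih =>
    obtain ⟨R, hR, rfl⟩ := succ_iff.1 h
    obtain ⟨R', hR', rfl⟩ := succ_iff.1 h'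
    constructor
    · refine succ_iff.2 ⟨_, (ih
        (hR.preimage (f := fun n : ℕ => Nat.pair n.unpair.1 n.unpair.2.unpair.1) (by fun_prop))
        (hR'.preimage (f := fun n : ℕ => Nat.pair n.unpair.1 n.unpair.2.unpair.2)
          (by fun_prop))).2, ?_⟩
      ext x
      simp only [coproj, Set.mem_inter_iff, Set.mem_ofPred_eq, Set.mem_union, Set.mem_preimage,
        Nat.unpair_pair, not_or]
      constructor
      · rintro ⟨⟨y, hy⟩, z, hz⟩
        exact ⟨Nat.pair y z, by simpa using hy, by simpa using hz⟩
      · rintro ⟨y, h1, h2⟩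
        exact ⟨⟨_, h1⟩, _, h2⟩
    · refine succ_iff.2 ⟨_, (ih hR hR').1, ?_⟩
      ext x
      simp only [coproj, Set.mem_inter_iff, Set.mem_ofPred_eq, Set.mem_union, not_and_or,
        exists_or]

end ArithLevel

/-- `P` is arithmetically definable from `G`. -/
@[fun_prop]
def ArithDef {α : Type*} [Primcodable α] (G : Set ℕ) (P : α → Prop) : Prop :=
  ∃ n S, ArithLevel G n S ∧ ∀ a, P a ↔ Encodable.encode a ∈ S

namespace ArithDef

variable {α β : Type*} [Primcodable α] [Primcodable β] {G : Set ℕ} {P Q : α → Prop}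

theorem of_iff (h : ArithDef G P) (hPQ : ∀ a, Q a ↔ P a) : ArithDef G Q := by
  rwa [show Q = P from funext fun a => propext (hPQ a)]

theorem comp {P : β → Prop} {f : α → β} (h : ArithDef G P) (hf : Primrec f) :
    ArithDef G fun a => P (f a) := by
  obtain ⟨n, S, hS, hP⟩ := h
  -- The code of `some b` is one more than the code of `b`, hence the predecessor.
  refine ⟨n, _, hS.preimage (f := fun n : ℕ => Nat.pred
    (Encodable.encode ((Encodable.decode (α := α) n).map f))) ?_, fun a => ?_⟩
  · exact Primrec.pred.comp (Primrec.nat_iff.2 hf)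
  · simp [hP]

theorem comp₂ {γ : Type*} [Primcodable γ] {P : β → γ → Prop} {f : α → β} {g : α → γ}
    (h : ArithDef G fun q : β × γ => P q.1 q.2) (hf : Primrec f) (hg : Primrec g) :
    ArithDef G fun a => P (f a) (g a) :=
  h.comp (hf.pair hg)

@[fun_prop]
theorem not (h : ArithDef G P) : ArithDef G fun a => ¬ P a := by
  obtain ⟨n, S, hS, hP⟩ := h
  exact ⟨_, _, hS.compl, fun a => by simp [hP]⟩

@[fun_prop]
theorem and (hP : ArithDef G P) (hQ : ArithDef G Q) : ArithDef G fun a => P a ∧ Q a := by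
  obtain ⟨n, S, hS, hP⟩ := hP
  obtain ⟨m, S', hS', hQ⟩ := hQ
  exact ⟨_, _, ((hS.mono (le_max_left n m)).inter_union (hS'.mono (le_max_right n m))).1,
    fun a => by simp [hP, hQ]⟩

@[fun_prop]
theorem or (hP : ArithDef G P) (hQ : ArithDef G Q) : ArithDef G fun a => P a ∨ Q a :=
  (hP.not.and hQ.not).not.of_iff fun a => by tauto

@[fun_prop]
theorem imp (hP : ArithDef G P) (hQ : ArithDef G Q) : ArithDef G fun a => P a → Q a :=
  (hP.and hQ.not).not.of_iff fun a => by tauto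

@[fun_prop]
theorem iff (hP : ArithDef G P) (hQ : ArithDef G Q) : ArithDef G fun a => P a ↔ Q a :=
  ((hP.imp hQ).and (hQ.imp hP)).of_iff fun a => by tauto

@[fun_prop]
theorem exist {P : α → ℕ → Prop} (h : ArithDef G fun q : α × ℕ => P q.1 q.2) :
    ArithDef G fun a => ∃ y, P a y := by
  obtain ⟨n, S, hS, hP⟩ := h
  refine ⟨n + 2, _, ArithLevel.succ_iff.2 ⟨_, hS.compl, rfl⟩, fun a => ?_⟩
  simp only [coproj, Set.mem_ofPred_eq, Set.mem_compl_iff, not_not]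
  exact exists_congr fun y => hP (a, y)

@[fun_prop]
theorem all {P : α → ℕ → Prop} (h : ArithDef G fun q : α × ℕ => P q.1 q.2) :
    ArithDef G fun a => ∀ y, P a y :=
  (exist (P := fun a y => ¬ P a y) h.not).not.of_iff fun a => by simp

theorem of_primrecPred (h : PrimrecPred P) : ArithDef G P := by
  classical
  have h' : PrimrecPred fun n => ∃ a : α, Encodable.decode n = some a ∧ P a := by
    have : Primrec fun n => (Encodable.decode (α := α) n).map fun a => decide (P a) :=
      Primrec.option_map Primrec.decode (h.decide.comp Primrec.snd)
    refine (Primrec.eq.comp this (Primrec.const (some true))).of_eq fun n => ?_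
    cases h : Encodable.decode (α := α) n <;> simp
  refine ⟨0, _, ⟨fun _ => 0, {n | ∃ a : α, Encodable.decode n.unpair.1 = some a ∧ P a},
    by fun_prop, h'.comp (f := fun n : ℕ => n.unpair.1) (by fun_prop), rfl⟩, fun a => ?_⟩
  simp [PrimQuery]

@[fun_prop]
theorem eq {f g : α → ℕ} (hf : Primrec f) (hg : Primrec g) : ArithDef G fun a => f a = g a :=
  of_primrecPred (Primrec.eq.comp hf hg)

@[fun_prop]
theorem lt {f g : α → ℕ} (hf : Primrec f) (hg : Primrec g) : ArithDef G fun a => f a < g a :=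
  of_primrecPred (Primrec.nat_lt.comp hf hg)

@[fun_prop]
theorem le {f g : α → ℕ} (hf : Primrec f) (hg : Primrec g) : ArithDef G fun a => f a ≤ g a :=
  of_primrecPred (Primrec.nat_le.comp hf hg)

@[fun_prop]
theorem mem_bits {f g : α → ℕ} (hf : Primrec f) (hg : Primrec g) :
    ArithDef G fun a => f a ∈ bits (g a) :=
  of_primrecPred (PrimrecPred.testBit hg hf)

@[fun_prop]
theorem bits_subset {f g : α → ℕ} (hf : Primrec f) (hg : Primrec g) :
    ArithDef G fun a => bits (f a) ⊆ bits (g a) :=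
  all (P := fun a i => i ∈ bits (f a) → i ∈ bits (g a))
    ((mem_bits (by fun_prop) (by fun_prop)).imp (mem_bits (by fun_prop) (by fun_prop)))

theorem mem_oracle : ArithDef G fun x => x ∈ G := by
  refine ⟨0, _, ⟨fun x => x + 1, {n | n.unpair.2.testBit n.unpair.1 = true}, by fun_prop,
    PrimrecPred.testBit (by fun_prop) (by fun_prop), rfl⟩, fun a => ?_⟩
  simp [PrimQuery, testBit_seg]

end ArithDef

/-! ### From relative computability to arithmetical definability. -/

theorem exists_beta_eq (g : ℕ → ℕ) (m : ℕ) : ∃ c, ∀ i < m, Nat.beta c i = g i := by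
  refine ⟨Nat.unbeta ((List.range m).map g), fun i hi => ?_⟩
  simpa using Nat.beta_unbeta_coe ((List.range m).map g) ⟨i, by simpa⟩

theorem Part.mem_nat_rec {β : Type*} (p : Part β) (h : ℕ → β → Part β) (n : ℕ) (y : β) :
    (y ∈ (n.rec p fun k IH => IH >>= h k : Part β)) ↔
      ∃ g : ℕ → β, g 0 ∈ p ∧ (∀ i, i < n → g (i + 1) ∈ h i (g i)) ∧ y = g n := by
  induction n generalizing y with
  | zero =>
    refine ⟨fun hy => ⟨fun _ => y, hy, by simp, rfl⟩, ?_⟩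
    rintro ⟨g, h0, -, rfl⟩
    exact h0
  | succ n ih =>
    refine Part.mem_bind_iff.trans ⟨?_, ?_⟩
    · rintro ⟨z, hz, hy⟩
      obtain ⟨g, h0, h1, rfl⟩ := (ih z).1 hz
      refine ⟨fun i => if i ≤ n then g i else y, by simpa, fun i hi => ?_, by simp⟩
      rcases Nat.lt_succ_iff_lt_or_eq.1 hi with hi | rfl
      · simpa [hi.le, Nat.succ_le_of_lt hi] using h1 i hi
      · simpa using hy
    · rintro ⟨g, h0, h1, rfl⟩
      exact ⟨g n, (ih _).2 ⟨g, h0, fun i hi => h1 i (by omega), rfl⟩, h1 n (by omega)⟩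

/-- Levels may grow freely, so no normal form for oracle computations is needed: induction on the
derivation suffices, with the beta function coding the history of a primitive recursion. -/
theorem ArithDef.graph_of_recursiveIn {G : Set ℕ} {f : ℕ →. ℕ}
    (hf : Nat.RecursiveIn {charFun G} f) : ArithDef G fun q : ℕ × ℕ => q.2 ∈ f q.1 := by
  induction hf with
  | zero =>
    exact of_iff (show ArithDef G fun q : ℕ × ℕ => q.2 = 0 by fun_prop) fun q => Part.mem_some_iff
  | succ =>
    exact of_iff (show ArithDef G fun q : ℕ × ℕ => q.2 = q.1.succ by fun_prop)
      fun q => by simp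
  | left =>
    exact of_iff (show ArithDef G fun q : ℕ × ℕ => q.2 = q.1.unpair.1 by fun_prop)
      fun q => by simp
  | right =>
    exact of_iff (show ArithDef G fun q : ℕ × ℕ => q.2 = q.1.unpair.2 by fun_prop)
      fun q => by simp
  | oracle g hg =>
    obtain rfl := Set.mem_singleton_iff.1 hg
    have h : ArithDef G fun q : ℕ × ℕ => q.1 ∈ G := mem_oracle.comp Primrec.fst
    refine of_iff (show ArithDef G fun q : ℕ × ℕ => (q.1 ∈ G ∧ q.2 = 1) ∨ (¬ q.1 ∈ G ∧ q.2 = 0) from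
      (h.and (by fun_prop)).or (h.not.and (by fun_prop))) fun q => ?_
    by_cases hq : q.1 ∈ G <;> simp [charFun, hq]
  | @pair f h _ _ ihf ihh =>
    refine of_iff (show ArithDef G fun q : ℕ × ℕ => ∃ a b, a ∈ f q.1 ∧ b ∈ h q.1 ∧ q.2 = Nat.pair a b
      from exist (exist ((comp₂ (P := fun x y => y ∈ f x) ihf (by fun_prop) (by fun_prop)).and
        ((comp₂ (P := fun x y => y ∈ h x) ihh (by fun_prop) (by fun_prop)).and
          (by fun_prop))))) fun q => ?_
    simp [Seq.seq, eq_comm]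
  | @comp f h _ _ ihf ihh =>
    refine of_iff (show ArithDef G fun q : ℕ × ℕ => ∃ a, a ∈ h q.1 ∧ q.2 ∈ f a
      from exist ((comp₂ (P := fun x y => y ∈ h x) ihh (by fun_prop) (by fun_prop)).and
        (comp₂ (P := fun x y => y ∈ f x) ihf (by fun_prop) (by fun_prop)))) fun q => ?_
    exact Part.mem_bind_iff
  | @prec f h _ _ ihf ihh =>
    refine of_iff (show ArithDef G fun q : ℕ × ℕ => ∃ c, Nat.beta c 0 ∈ f q.1.unpair.1 ∧
      (∀ i, i < q.1.unpair.2 → Nat.beta c (i + 1) ∈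
        h (Nat.pair q.1.unpair.1 (Nat.pair i (Nat.beta c i)))) ∧ q.2 = Nat.beta c q.1.unpair.2
      from exist ((comp₂ (P := fun x y => y ∈ f x) ihf (by fun_prop) (by fun_prop)).and
        ((all (imp (by fun_prop)
          (comp₂ (P := fun x y => y ∈ h x) ihh (by fun_prop) (by fun_prop)))).and
            (by fun_prop)))) fun q => ?_
    obtain ⟨x, y⟩ := q
    refine (Part.mem_nat_rec (f x.unpair.1) (fun k i => h (Nat.pair x.unpair.1 (Nat.pair k i)))
      x.unpair.2 y).trans ⟨?_, ?_⟩
    · rintro ⟨g, h0, h1, rfl⟩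
      obtain ⟨c, hc⟩ := exists_beta_eq g (x.unpair.2 + 1)
      refine ⟨c, by rwa [hc 0 (by omega)], fun i hi => ?_, (hc _ (by omega)).symm⟩
      rw [hc i (by dsimp at hi; omega), hc (i + 1) (by dsimp at hi; omega)]
      exact h1 i hi
    · rintro ⟨c, h0, h1, h2⟩
      exact ⟨_, h0, h1, h2⟩
  | @rfind f _ ih =>
    refine of_iff (show ArithDef G fun q : ℕ × ℕ => 0 ∈ f (Nat.pair q.1 q.2) ∧
      ∀ m, m < q.2 → ∃ v, v ≠ 0 ∧ v ∈ f (Nat.pair q.1 m) from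
      (comp₂ (P := fun x y => y ∈ f x) ih (by fun_prop) (by fun_prop)).and
        (all (imp (by fun_prop) (exist (and (by fun_prop)
          (comp₂ (P := fun x y => y ∈ f x) ih (by fun_prop) (by fun_prop))))))) fun q => ?_
    refine Nat.mem_rfind.trans ?_
    simp [and_comm]

theorem ArithDef.of_sigmaZero {G : Set ℕ} {n : ℕ} {B : Set ℕ} (h : SigmaZero G n B) :
    ArithDef G fun x => x ∈ B := by
  induction n generalizing B with
  | zero =>
    have h' := graph_of_recursiveIn (RecursiveIn.iff_nat.1 h)
    refine (h'.comp (f := fun x => (x, 1)) (by fun_prop)).of_iff fun x => ?_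
    by_cases hx : x ∈ B <;> simp [charFun, hx]
  | succ n ih =>
    obtain ⟨R, hR, hB⟩ := h
    refine of_iff (exist (P := fun x y => ¬ Nat.pair x y ∈ R) ?_) hB
    exact ((ih hR).comp (f := fun q : ℕ × ℕ => Nat.pair q.1 q.2) (by fun_prop)).not

theorem PrimrecPred.setComputableIn {S : Set ℕ} (hS : PrimrecPred (· ∈ S)) (X : Set ℕ) :
    SetComputableIn X S := by
  classical
  have h : Primrec fun n => if n ∈ S then 1 else 0 :=
    Primrec.ite hS (Primrec.const 1) (Primrec.const 0)
  refine RecursiveIn.of_eq h.computableIn.recursiveIn fun n => ?_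
  by_cases hn : n ∈ S <;> simp [charFun, hn]

theorem ArithLevel.sigmaZero_empty {n : ℕ} {S : Set ℕ} (h : ArithLevel ∅ n S) :
    SigmaZero ∅ n S := by
  induction n generalizing S with
  | zero =>
    obtain ⟨u, W, hu, hW, rfl⟩ := h
    have h0 : ∀ m, seg ∅ m = 0 := fun m => bits_injective (by rw [bits_seg]; ext; simp [bits])
    refine PrimrecPred.setComputableIn ?_ ∅
    simpa [PrimQuery, h0] using hW.comp (f := fun n : ℕ => Nat.pair n 0) (by fun_prop)
  | succ n ih =>
    obtain ⟨R, hR, rfl⟩ := succ_iff.1 h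
    exact ⟨R, ih hR, fun x => Iff.rfl⟩

theorem ArithDef.arithmetical {S : Set ℕ} (h : ArithDef ∅ fun x => x ∈ S) : Arithmetical S := by
  obtain ⟨n, S', hS', hS⟩ := h
  obtain rfl : S = S' := Set.ext hS
  exact ⟨n, hS'.sigmaZero_empty⟩

/-! ### Ultrafilters, finite subsets and colourings. -/

open Filter

/-- Monotone predicates on (codes of) finite sets. -/
def MonoBits (V : ℕ → Prop) : Prop := ∀ a b, bits a ⊆ bits b → V a → V b

/-- Every element of the ultrafilter `p` has a finite subset satisfying `V`. -/
def Within (p : Ultrafilter ℕ) (V : ℕ → Prop) : Prop := ∀ Y ∈ p, ∃ a, bits a ⊆ Y ∧ V a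

/-- Monotonicity replaces an arbitrary witness by all long initial segments of `Y`, so finitely many
requirements can share one witness. -/
theorem MonoBits.exists_iff_eventually {V : ℕ → Prop} (hV : MonoBits V) (Y : Set ℕ) :
    (∃ a, bits a ⊆ Y ∧ V a) ↔ ∀ᶠ m in atTop, V (seg Y m) := by
  constructor
  · rintro ⟨a, haY, ha⟩
    filter_upwards [eventually_ge_atTop a] with m hm
    refine hV a _ (fun i hi => ?_) ha
    rw [bits_seg]
    exact ⟨(lt_of_mem_bits hi).trans_le hm, haY hi⟩
  · intro h
    obtain ⟨m, hm⟩ := h.exists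
    exact ⟨_, by rw [bits_seg]; exact fun i hi => hi.2, hm⟩

theorem MonoBits.ball {V : ℕ → ℕ → Prop} (hV : ∀ i, MonoBits (V i)) (s : Set ℕ) :
    MonoBits fun a => ∀ i ∈ s, V i a :=
  fun a b hab h i hi => hV i a b hab (h i hi)

theorem within_ball {V : ℕ → ℕ → Prop} (hV : ∀ i, MonoBits (V i)) {s : Set ℕ} (hs : s.Finite)
    (p : Ultrafilter ℕ) : Within p (fun a => ∀ i ∈ s, V i a) ↔ ∀ i ∈ s, Within p (V i) := by
  constructor
  · intro h i hi Y hY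
    obtain ⟨a, haY, ha⟩ := h Y hY
    exact ⟨a, haY, ha i hi⟩
  · intro h Y hY
    rw [(MonoBits.ball hV s).exists_iff_eventually, eventually_all_finite hs]
    exact fun i hi => ((hV i).exists_iff_eventually Y).1 (h i hi Y hY)

theorem MonoBits.and {V V' : ℕ → Prop} (hV : MonoBits V) (hV' : MonoBits V') :
    MonoBits fun a => V a ∧ V' a :=
  fun a b hab h => ⟨hV a b hab h.1, hV' a b hab h.2⟩

theorem within_and {V V' : ℕ → Prop} (hV : MonoBits V) (hV' : MonoBits V') (p : Ultrafilter ℕ) :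
    Within p (fun a => V a ∧ V' a) ↔ Within p V ∧ Within p V' := by
  constructor
  · exact fun h => ⟨fun Y hY => (h Y hY).imp fun a ha => ⟨ha.1, ha.2.1⟩,
      fun Y hY => (h Y hY).imp fun a ha => ⟨ha.1, ha.2.2⟩⟩
  · intro h Y hY
    rw [(hV.and hV').exists_iff_eventually]
    exact ((hV.exists_iff_eventually Y).1 (h.1 Y hY)).and
      ((hV'.exists_iff_eventually Y).1 (h.2 Y hY))

theorem isClosed_within (V : ℕ → Prop) : IsClosed {p : Ultrafilter ℕ | Within p V} := by
  have : {p : Ultrafilter ℕ | Within p V} =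
      ⋂ Y : {Y : Set ℕ // ¬ ∃ a, bits a ⊆ Y ∧ V a}, {p : Ultrafilter ℕ | Y.1 ∈ p}ᶜ := by
    ext p
    simp only [Set.mem_ofPred_eq, Set.mem_iInter, Set.mem_compl_iff, Subtype.forall, Within]
    exact forall_congr' fun Y => ⟨fun h h' hY => h' (h hY), fun h hY => by_contra fun h' => h h' hY⟩
  rw [this]
  exact isClosed_iInter fun Y => (ultrafilter_isOpen_basic Y.1).isClosed_compl

/-- The finite sets satisfying `V` form a hypergraph of infinite chromatic number, in the form of
a property of colourings of finite sets, which are coded by the beta function. -/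
def Large (V : ℕ → Prop) : Prop :=
  ∀ k, ∃ m, ∀ f, (∀ i, i < m → Nat.beta f i < k) →
    ∃ j, j < k ∧ ∃ a, V a ∧ ∀ i, i ∈ bits a → i < m ∧ Nat.beta f i = j

/-- Bad colourings of all finite intervals have a limit colouring along a nonprincipal ultrafilter.
One of its colour classes lies in `p` and so contains a finite set in `V`, on which some long bad
colouring agrees with the limit. -/
theorem Within.large {V : ℕ → Prop} {p : Ultrafilter ℕ} (hp : Within p V) : Large V := by
  by_contra h
  simp only [Large, not_forall, not_exists] at h
  obtain ⟨k, h⟩ := h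
  choose f hf hbad using h
  have hq : ∀ n : ℕ, ∀ᶠ m in (hyperfilter ℕ : Filter ℕ), n < m := fun n =>
    Nat.hyperfilter_le_atTop (eventually_gt_atTop n)
  have hF : ∀ i, ∃ j ∈ Set.Iio k, ∀ᶠ m in (hyperfilter ℕ : Filter ℕ), Nat.beta (f m) i = j := by
    intro i
    rw [← Ultrafilter.eventually_exists_mem_iff (Set.finite_Iio k)]
    filter_upwards [hq i] with m hm
    exact ⟨_, hf m i hm, rfl⟩
  choose F hFk hF using hF
  obtain ⟨j, hj, hjp⟩ : ∃ j ∈ Set.Iio k, ∀ᶠ i in (p : Filter ℕ), F i = j := by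
    rw [← Ultrafilter.eventually_exists_mem_iff (Set.finite_Iio k)]
    exact Eventually.of_forall fun i => ⟨_, hFk i, rfl⟩
  obtain ⟨a, haF, ha⟩ := hp _ hjp
  have hev : ∀ᶠ m in (hyperfilter ℕ : Filter ℕ), ∀ i ∈ bits a, Nat.beta (f m) i = F i :=
    (eventually_all_finite ((Set.finite_lt_nat a).subset fun i hi => lt_of_mem_bits hi)).2
      fun i _ => hF i
  obtain ⟨m, hm, ham⟩ := (hev.and (hq a)).exists
  exact hbad m j ⟨hj, a, ha, fun i hi =>
    ⟨(lt_of_mem_bits hi).trans ham, (hm i hi).trans (haF hi)⟩⟩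

/-- The complements of the sets without a subset in `V` generate a proper filter: finitely many such
sets covering the numbers would define a colouring with no monochromatic set in `V`. -/
theorem Large.exists_within {V : ℕ → Prop} (hV : Large V) : ∃ p, Within p V := by
  let s : Set (Set ℕ) := {Z | ¬ ∃ a, bits a ⊆ Zᶜ ∧ V a}
  have hs : (generate s).NeBot := by
    refine generate_neBot_iff.2 fun t hts htf => ?_
    by_contra hne
    have hcov : ∀ i, ∃ Z : t, i ∉ Z.1 := by
      intro i
      by_contra hi
      push Not at hi
      exact hne ⟨i, fun Z hZ => hi ⟨Z, hZ⟩⟩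
    choose Z hZ using hcov
    have := htf.to_subtype
    obtain ⟨k, ⟨e⟩⟩ := Finite.exists_equiv_fin t
    obtain ⟨m, hm⟩ := hV k
    obtain ⟨f, hf⟩ := exists_beta_eq (fun i => (e (Z i) : ℕ)) m
    obtain ⟨j, hj, a, ha, haj⟩ := hm f fun i hi => by rw [hf i hi]; exact (e (Z i)).2
    refine hts (e.symm ⟨j, hj⟩).2 ⟨a, fun i hi => ?_, ha⟩
    obtain ⟨him, hij⟩ := haj i hi
    rw [hf i him] at hij
    have : e.symm ⟨j, hj⟩ = Z i := by simp [← hij]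
    rw [this]
    exact hZ i
  refine ⟨Ultrafilter.of (generate s), fun Y hY => ?_⟩
  by_contra h
  have hYs : Yᶜ ∈ s := by simpa [s] using h
  exact Ultrafilter.compl_notMem_iff.2 hY
    (Ultrafilter.of_le _ (mem_generate_of_mem hYs))

theorem ArithDef.large {α : Type*} [Primcodable α] {G : Set ℕ} {V : α → ℕ → Prop}
    (hV : ArithDef G fun q : α × ℕ => V q.1 q.2) : ArithDef G fun c => Large (V c) :=
  all (exist (all (imp (by fun_prop) (exist (and (by fun_prop) (exist (and
    (comp₂ (P := V) hV (by fun_prop) (by fun_prop)) (by fun_prop))))))))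

theorem seg_add_two_pow (D : Set ℕ) (j : ℕ) : seg D j + 2 ^ j = seg (insert j D) (j + 1) := by
  rw [seg_succ_of_mem (Set.mem_insert j D)]
  congr 1
  exact seg_congr fun i hi => by simp [hi.ne]

/-- The greedy choice of a set relative to a predicate on (codes of) finite sets. -/
theorem exists_greedy {G : Set ℕ} {C : ℕ → Prop} (hC : ArithDef G C) :
    ∃ D : Set ℕ, ArithDef G (fun i => i ∈ D) ∧ ∀ i, i ∈ D ↔ C (seg D i + 2 ^ i) := by
  classical
  let g : ℕ → ℕ := fun m => m.rec 0 fun i s => if C (s + 2 ^ i) then s + 2 ^ i else s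
  let D : Set ℕ := {i | C (g i + 2 ^ i)}
  have hg : ∀ i, g i = seg D i := by
    intro i
    induction i with
    | zero => rfl
    | succ i ih =>
      have hgi : g (i + 1) = if C (g i + 2 ^ i) then g i + 2 ^ i else g i := rfl
      by_cases hi : i ∈ D
      · rw [seg_succ_of_mem hi, ← ih, hgi]
        exact if_pos hi
      · rw [seg_succ_of_notMem hi, ← ih, hgi]
        exact if_neg hi
  have hD : ∀ i, i ∈ D ↔ C (seg D i + 2 ^ i) := fun i => by rw [← hg]; rfl
  -- The recursion is replaced by a number `c` whose digits up to `i` obey the greedy rule; `c % 2 ^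
  -- j` codes the choices made before `j`.
  refine ⟨D, ArithDef.of_iff (Q := fun i => i ∈ D) (P := fun i => ∃ c, (∀ j, j ≤ i →
    (j ∈ bits c ↔ C (c % 2 ^ j + 2 ^ j))) ∧ i ∈ bits c) ?_ fun i => ⟨fun hi => ?_, ?_⟩, hD⟩
  · exact .exist (.and (.all (.imp (by fun_prop) (.iff (by fun_prop)
      (hC.comp (f := fun q : (ℕ × ℕ) × ℕ => q.1.2 % 2 ^ q.2 + 2 ^ q.2) (by fun_prop)))))
      (by fun_prop))
  · refine ⟨seg D (i + 1), fun j hj => ?_, by rw [bits_seg]; exact ⟨by omega, hi⟩⟩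
    rw [seg_mod D (i + 1) j (by omega), ← hD, bits_seg]
    simp only [Set.mem_ofPred_eq, and_iff_right_iff_imp]
    omega
  · rintro ⟨c, hc, hic⟩
    have key : ∀ j, j ≤ i → (j ∈ bits c ↔ j ∈ D) := by
      intro j
      induction j using Nat.strong_induction_on with
      | _ j ih =>
        intro hj
        rw [hc j hj, hD, ← seg_bits, seg_congr fun l hl => ih l hl (by omega)]
    exact (key i le_rfl).1 hic

/-! ### Closed sets of ultrafilters and arithmetical decisions. -/

/-- A nonempty closed set of ultrafilters, presented by an arithmetical sequence of monotone
predicates on finite sets. -/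
structure UltraStage where
  U : ℕ → ℕ → Prop
  arith : ArithDef ∅ fun q : ℕ × ℕ => U q.1 q.2
  mono : ∀ i, MonoBits (U i)
  nonempty : ∃ p, ∀ i, Within p (U i)

/-- The set of ultrafilters presented by a stage. -/
def UltraStage.points (S : UltraStage) : Set (Ultrafilter ℕ) := {p | ∀ i, Within p (S.U i)}

theorem UltraStage.isClosed_points (S : UltraStage) : IsClosed S.points := by
  simp only [UltraStage.points, Set.ofPred_forall]
  exact isClosed_iInter fun i => isClosed_within _

theorem exists_within_of_forall_lt {U : ℕ → ℕ → Prop}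
    {K : Set (Ultrafilter ℕ)} (hK : IsClosed K)
    (h : ∀ n, ∃ p ∈ K, ∀ i < n, Within p (U i)) : ∃ p ∈ K, ∀ i, Within p (U i) := by
  let t : ℕ → Set (Ultrafilter ℕ) := fun n => K ∩ ⋂ i ∈ Set.Iio n, {p | Within p (U i)}
  have ht : ∀ n, IsClosed (t n) := fun n =>
    hK.inter (isClosed_biInter fun i _ => isClosed_within _)
  obtain ⟨p, hp⟩ := IsCompact.nonempty_iInter_of_sequence_nonempty_isCompact_isClosed t
    (fun n => Set.inter_subset_inter_right _
      (Set.biInter_subset_biInter_left fun i hi => Nat.lt_succ_of_lt hi))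
    (fun n => (h n).imp fun p hp => ⟨hp.1, by simpa using hp.2⟩) (ht 0).isCompact ht
  have hp' := Set.mem_iInter.1 hp
  refine ⟨p, (hp' 0).1, fun i => ?_⟩
  have := (hp' (i + 1)).2
  simp only [Set.mem_iInter] at this
  exact this i (Nat.lt_succ_self i)

namespace UltraStage

variable (S : UltraStage) {V : ℕ → ℕ → Prop}

/-- Some point of the stage satisfies the finitely many requirements coded by `c`. -/
def Compatible (V : ℕ → ℕ → Prop) (c : ℕ) : Prop := ∃ p ∈ S.points, ∀ l ∈ bits c, Within p (V l)

/-- Compactness reduces the stage to finitely many of its requirements, whose conjunction is one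
monotone predicate. This removes the quantifier over ultrafilters. -/
theorem compatible_iff (hV : ∀ i, MonoBits (V i)) (c : ℕ) :
    S.Compatible V c ↔ ∀ n, Large fun a => (∀ i ∈ Set.Iio n, S.U i a) ∧ ∀ l ∈ bits c, V l a := by
  have key : ∀ n p, Within p (fun a => (∀ i ∈ Set.Iio n, S.U i a) ∧ ∀ l ∈ bits c, V l a) ↔
      (∀ i ∈ Set.Iio n, Within p (S.U i)) ∧ ∀ l ∈ bits c, Within p (V l) := fun n p => by
    rw [within_and (.ball S.mono _) (.ball hV _), within_ball S.mono (Set.finite_Iio n),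
      within_ball hV (bits_finite c)]
  constructor
  · rintro ⟨p, hp, hpc⟩ n
    exact Within.large ((key n p).2 ⟨fun i _ => hp i, hpc⟩)
  · intro h
    obtain ⟨p, hpc, hp⟩ := exists_within_of_forall_lt (U := S.U)
      (K := ⋂ l ∈ bits c, {p | Within p (V l)}) (isClosed_biInter fun i _ => isClosed_within _)
      fun n => by
        obtain ⟨p, hp⟩ := (h n).exists_within
        rw [key] at hp
        exact ⟨p, by simpa using hp.2, hp.1⟩
    exact ⟨p, hp, by simpa using hpc⟩

theorem arithDef_compatible (hV : ∀ i, MonoBits (V i))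
    (hVa : ArithDef ∅ fun q : ℕ × ℕ => V q.1 q.2) : ArithDef ∅ (S.Compatible V) := by
  refine .of_iff (.all (.large (V := fun q : ℕ × ℕ => fun a =>
    (∀ i ∈ Set.Iio q.2, S.U i a) ∧ ∀ l ∈ bits q.1, V l a) ?_)) (S.compatible_iff hV)
  refine .and (.all (.imp ?_ (.comp₂ (P := S.U) S.arith (by fun_prop) (by fun_prop))))
    (.all (.imp (by fun_prop) (.comp₂ (P := V) hVa (by fun_prop) (by fun_prop))))
  exact ArithDef.lt (f := fun q : ((ℕ × ℕ) × ℕ) × ℕ => q.2) (g := fun q => q.1.1.2)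
    (by fun_prop) (by fun_prop)

/-- A requirement is accepted whenever it is compatible with the stage and those accepted before. A
point of the new stage satisfying `V i` itself witnesses that `i` was compatible at its turn, so no
rejected requirement holds there. -/
theorem exists_decide (hV : ∀ i, MonoBits (V i))
    (hVa : ArithDef ∅ fun q : ℕ × ℕ => V q.1 q.2) :
    ∃ S' : UltraStage, S'.points ⊆ S.points ∧ ∃ D : Set ℕ, ArithDef ∅ (fun i => i ∈ D) ∧
      ∀ p ∈ S'.points, ∀ i, Within p (V i) ↔ i ∈ D := by
  obtain ⟨D, hDa, hD⟩ := exists_greedy (S.arithDef_compatible hV hVa)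
  have hcomp : ∀ n, S.Compatible V (seg D n) := by
    intro n
    induction n with
    | zero =>
      obtain ⟨p, hp⟩ := S.nonempty
      exact ⟨p, hp, fun l hl => by simp [bits, seg_zero] at hl⟩
    | succ n ih =>
      by_cases hn : n ∈ D
      · rw [seg_succ_of_mem hn]
        exact (hD n).1 hn
      · rwa [seg_succ_of_notMem hn]
  have hmono : ∀ i, MonoBits fun a => i ∈ D → V i a := fun i a b hab h hi => hV i a b hab (h hi)
  have hwithin : ∀ p i, Within p (fun a => S.U i a ∧ (i ∈ D → V i a)) ↔
      Within p (S.U i) ∧ (i ∈ D → Within p (V i)) := by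
    intro p i
    rw [within_and (S.mono i) (hmono i)]
    refine and_congr_right fun _ => ?_
    by_cases hi : i ∈ D
    · simp [hi]
    · simp only [hi, false_imp_iff, iff_true]
      -- A rejected requirement is vacuous, and the empty set, coded by `0`, meets it.
      exact fun Y _ => ⟨0, by simp [bits], trivial⟩
  have hne : ∃ p ∈ S.points, ∀ i, Within p fun a => i ∈ D → V i a := by
    refine exists_within_of_forall_lt S.isClosed_points fun n => ?_
    obtain ⟨p, hp, hpn⟩ := hcomp n
    refine ⟨p, hp, fun i hi => ?_⟩
    by_cases hiD : i ∈ D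
    · have := hpn i (by rw [bits_seg]; exact ⟨hi, hiD⟩)
      simpa [hiD] using this
    · exact fun Y _ => ⟨0, by simp [bits], fun h => absurd h hiD⟩
  refine ⟨⟨fun i a => S.U i a ∧ (i ∈ D → V i a), S.arith.and ((hDa.comp Primrec.fst).imp hVa),
    fun i => (S.mono i).and (hmono i), ?_⟩, ?_, D, hDa, ?_⟩
  · obtain ⟨p, hp, hpD⟩ := hne
    exact ⟨p, fun i => (within_and (S.mono i) (hmono i) p).2 ⟨hp i, hpD i⟩⟩
  · exact fun p hp i => ((hwithin p i).1 (hp i)).1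
  · refine fun p hp i => ⟨fun h => (hD i).2 ⟨p, fun j => ((hwithin p j).1 (hp j)).1, ?_⟩,
      fun h => ((hwithin p i).1 (hp i)).2 h⟩
    intro l hl
    rw [seg_add_two_pow, bits_seg] at hl
    obtain ⟨-, rfl | hl⟩ := hl
    · exact h
    · exact ((hwithin p l).1 (hp l)).2 hl

end UltraStage

/-- The Rasiowa–Sikorski construction, used both for stages and for Mathias conditions. -/
theorem exists_chain_meeting {α ι : Type*} [Countable ι] {r : α → α → Prop}
    (hr : ∀ a, r a a) (ht : ∀ a b c, r a b → r b c → r a c) (a₀ : α) {D : ι → α → Prop}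
    (hD : ∀ i a, ∃ b, r a b ∧ D i b) :
    ∃ s : ℕ → α, s 0 = a₀ ∧ (∀ m n, m ≤ n → r (s m) (s n)) ∧ ∀ i, ∃ n, D i (s n) := by
  rcases isEmpty_or_nonempty ι with hι | hι
  · exact ⟨fun _ => a₀, rfl, fun _ _ _ => hr _, fun i => hι.elim i⟩
  obtain ⟨e, he⟩ := exists_surjective_nat ι
  choose next hnext hnextD using hD
  let s : ℕ → α := fun n => n.rec a₀ fun k a => next (e k) a
  refine ⟨s, rfl, fun m n hmn => ?_, fun i => ?_⟩
  · induction hmn with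
    | refl => exact hr _
    | @step n _ ih => exact ht _ _ _ ih (hnext (e n) (s n))
  · obtain ⟨k, rfl⟩ := he i
    exact ⟨k + 1, hnextD (e k) (s k)⟩

/-! ### The forcing question and the choice of the ultrafilter. -/

/-- The forcing question: a `Σₙ`-style answer, computed along the ultrafilter `p`, to whether the
finite set coded by `a` may be extended so that `x` enters `coproj^[n] (PrimQuery u W G)`. -/
def question (p : Ultrafilter ℕ) (u : ℕ → ℕ) (W : Set ℕ) : ℕ → ℕ → ℕ → Prop
  | 0, a, x => Nat.pair x (a % 2 ^ u x) ∈ W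
  | n + 1, a, x => ∀ Y ∈ p, ∃ a', bits a ⊆ bits a' ∧ bits a' ⊆ bits a ∪ Y ∧
      ∃ y, ¬ question p u W n a' (Nat.pair x y)

/-- The finite-set predicate which expresses the next level of the forcing question in terms of a
decision `D` of the current one. -/
def questionStep (D : ℕ → ℕ → Prop) (i b : ℕ) : Prop :=
  ∃ a', bits i.unpair.1 ⊆ bits a' ∧ (∀ j, j ∈ bits a' → j ∈ bits i.unpair.1 ∨ j ∈ bits b) ∧
    ∃ y, ¬ D a' (Nat.pair i.unpair.2 y)

theorem monoBits_questionStep (D : ℕ → ℕ → Prop) (i : ℕ) : MonoBits (questionStep D i) := by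
  rintro b c hbc ⟨a', h1, h2, h3⟩
  exact ⟨a', h1, fun j hj => (h2 j hj).imp_right fun h => hbc h, h3⟩

theorem ArithDef.questionStep {G : Set ℕ} {D : ℕ → ℕ → Prop}
    (hD : ArithDef G fun q : ℕ × ℕ => D q.1 q.2) :
    ArithDef G fun q : ℕ × ℕ => questionStep D q.1 q.2 :=
  exist (and (by fun_prop) (and (by fun_prop)
    (exist (not (comp₂ (P := D) hD (by fun_prop) (by fun_prop))))))

theorem within_questionStep_iff {p : Ultrafilter ℕ} {D : ℕ → ℕ → Prop} {a x : ℕ} :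
    Within p (questionStep D (Nat.pair a x)) ↔ ∀ Y ∈ p, ∃ a', bits a ⊆ bits a' ∧
      bits a' ⊆ bits a ∪ Y ∧ ∃ y, ¬ D a' (Nat.pair x y) := by
  refine forall₂_congr fun Y _ => ?_
  simp only [questionStep, Nat.unpair_pair]
  constructor
  · rintro ⟨b, hbY, a', h1, h2, h3⟩
    exact ⟨a', h1, fun j hj => (h2 j hj).imp_right fun h => hbY h, h3⟩
  · rintro ⟨a', h1, h2, h3⟩
    -- Only the elements added to the stem have to come from `Y`.
    obtain ⟨b, hb⟩ := exists_bits_eq ((bits_finite a').sdiff (t := bits a))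
    refine ⟨b, ?_, a', h1, fun j hj => ?_, h3⟩
    · rw [hb]
      exact fun j hj => (h2 hj.1).resolve_left hj.2
    · by_cases hja : j ∈ bits a
      · exact .inl hja
      · exact .inr (hb ▸ ⟨hj, hja⟩)

/-- Once level `n` has the same arithmetical answers `D` at all points, level `n + 1` is a sequence
of `Within` questions about a predicate free of `p`, which a smaller stage decides. -/
theorem UltraStage.exists_decide_question {u : ℕ → ℕ} {W : Set ℕ} (hu : Primrec u)
    (hW : PrimrecPred (· ∈ W)) (n : ℕ) (S : UltraStage) :
    ∃ S' : UltraStage, S'.points ⊆ S.points ∧ ∃ D : ℕ → ℕ → Prop,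
      ArithDef ∅ (fun q : ℕ × ℕ => D q.1 q.2) ∧
      ∀ p ∈ S'.points, ∀ a x, question p u W n a x ↔ D a x := by
  induction n with
  | zero =>
    refine ⟨S, subset_rfl, fun a x => Nat.pair x (a % 2 ^ u x) ∈ W, ?_, fun p _ a x => Iff.rfl⟩
    exact (ArithDef.of_primrecPred hW).comp
      (f := fun q : ℕ × ℕ => Nat.pair q.2 (q.1 % 2 ^ u q.2)) (by fun_prop)
  | succ n ih =>
    obtain ⟨S₁, h₁, D, hD, hq⟩ := ih
    obtain ⟨S₂, h₂, E, hE, hqE⟩ := S₁.exists_decide (monoBits_questionStep D) hD.questionStep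
    refine ⟨S₂, h₂.trans h₁, fun a x => Nat.pair a x ∈ E,
      hE.comp (f := fun q : ℕ × ℕ => Nat.pair q.1 q.2) (by fun_prop), fun p hp a x => ?_⟩
    refine Iff.trans ?_ (within_questionStep_iff.symm.trans (hqE p hp (Nat.pair a x)))
    simp only [question, hq p (h₂ hp)]

/-- The stage whose points are the nonprincipal ultrafilters. -/
def UltraStage.nonprincipal : UltraStage where
  U i a := ∃ j, j ∈ bits a ∧ i ≤ j
  arith := by fun_prop
  mono _ _ _ hab := fun ⟨j, hj, hij⟩ => ⟨j, hab hj, hij⟩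
  nonempty := by
    refine ⟨hyperfilter ℕ, fun i Y hY => ?_⟩
    have : Y.Infinite := fun h => notMem_hyperfilter_of_finite h hY
    obtain ⟨j, hjY, hij⟩ := this.exists_gt i
    obtain ⟨a, ha⟩ := exists_bits_eq (Set.finite_singleton j)
    exact ⟨a, by simpa [ha] using hjY, j, by simp [ha], hij.le⟩

theorem UltraStage.infinite_of_mem_nonprincipal {p : Ultrafilter ℕ}
    (hp : p ∈ UltraStage.nonprincipal.points) {Y : Set ℕ} (hY : Y ∈ p) : Y.Infinite := by
  refine Set.infinite_of_forall_exists_gt fun i => ?_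
  obtain ⟨a, haY, j, hj, hij⟩ := hp (i + 1) Y hY
  exact ⟨j, haY hj, hij⟩

theorem countable_primrec : Countable {u : ℕ → ℕ // Primrec u} := by
  have h : ∀ u : {u : ℕ → ℕ // Primrec u}, ∃ c : Nat.Partrec.Code, c.eval = fun n => u.1 n :=
    fun u => Nat.Partrec.Code.exists_code.1 (Nat.Partrec.of_primrec (Primrec.nat_iff.1 u.2))
  choose c hc using h
  refine Function.Injective.countable (f := c) fun u v huv => Subtype.ext (funext fun n => ?_)
  have := (hc u).symm.trans (huv ▸ hc v)
  exact Part.some_injective (congrFun this n)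

theorem countable_primrecPred : Countable {W : Set ℕ // PrimrecPred (· ∈ W)} := by
  classical
  have := countable_primrec
  let f : {W : Set ℕ // PrimrecPred (· ∈ W)} → {u : ℕ → ℕ // Primrec u} := fun W =>
    ⟨fun n => if n ∈ W.1 then 1 else 0, Primrec.ite W.2 (Primrec.const 1) (Primrec.const 0)⟩
  refine Function.Injective.countable (f := f) fun W W' h => Subtype.ext (Set.ext fun n => ?_)
  have hn := congrFun (congrArg Subtype.val h) n
  by_cases h1 : n ∈ W.1 <;> by_cases h2 : n ∈ W'.1 <;> simp_all [f]

/-- A nonprincipal ultrafilter whose forcing questions are all arithmetical. -/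
theorem exists_ultrafilter_arithDef_question :
    ∃ p : Ultrafilter ℕ, (∀ Y ∈ p, Y.Infinite) ∧ ∀ u W, Primrec u → PrimrecPred (· ∈ W) →
      ∀ n, ArithDef ∅ fun q : ℕ × ℕ => question p u W n q.1 q.2 := by
  have := countable_primrec
  have := countable_primrecPred
  obtain ⟨s, hs0, hs, hsD⟩ := exists_chain_meeting
    (ι := ℕ × {u : ℕ → ℕ // Primrec u} × {W : Set ℕ // PrimrecPred (· ∈ W)})
    (r := fun S S' : UltraStage => S'.points ⊆ S.points)
    (fun _ => subset_rfl) (fun _ _ _ h h' => h'.trans h) UltraStage.nonprincipal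
    (fun i S => S.exists_decide_question i.2.1.2 i.2.2.2 i.1)
  obtain ⟨p, hp⟩ := IsCompact.nonempty_iInter_of_sequence_nonempty_isCompact_isClosed
    (fun n => (s n).points) (fun n => hs _ _ n.le_succ) (fun n => (s n).nonempty)
    (s 0).isClosed_points.isCompact fun n => (s n).isClosed_points
  have hp' := Set.mem_iInter.1 hp
  refine ⟨p, fun Y hY => UltraStage.infinite_of_mem_nonprincipal (hs0 ▸ hp' 0) hY,
    fun u W hu hW n => ?_⟩
  obtain ⟨k, D, hD, hq⟩ := hsD (n, ⟨u, hu⟩, ⟨W, hW⟩)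
  exact hD.of_iff fun q => hq p (hp' k) q.1 q.2

/-! ### Mathias forcing along the ultrafilter. -/

/-- Mathias conditions with reservoir in the ultrafilter `p`: a finite set coded by `stem`, to be
extended by elements of `res`. -/
structure MathiasCond (p : Ultrafilter ℕ) where
  stem : ℕ
  res : Set ℕ
  res_mem : res ∈ p

namespace MathiasCond

variable {p : Ultrafilter ℕ} {u : ℕ → ℕ} {W : Set ℕ}

/-- `d` extends `c`. -/
def Ext (c d : MathiasCond p) : Prop :=
  bits c.stem ⊆ bits d.stem ∧ bits d.stem ⊆ bits c.stem ∪ c.res ∧ d.res ⊆ c.res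

theorem Ext.refl (c : MathiasCond p) : c.Ext c :=
  ⟨subset_rfl, Set.subset_union_left, subset_rfl⟩

theorem Ext.trans {c d e : MathiasCond p} (h : c.Ext d) (h' : d.Ext e) : c.Ext e :=
  ⟨h.1.trans h'.1, h'.2.1.trans (Set.union_subset h.2.1 (h.2.2.trans Set.subset_union_right)),
    h'.2.2.trans h.2.2⟩

/-- The condition forces `x ∉ coproj^[n] (PrimQuery u W G)`. -/
def ForcesNotMem (u : ℕ → ℕ) (W : Set ℕ) : ℕ → MathiasCond p → ℕ → Prop
  | 0, c, x => (∀ i < u x, i ∈ c.res → i ∈ bits c.stem) ∧ ¬ question p u W 0 c.stem x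
  | n + 1, c, x => ∀ a', bits c.stem ⊆ bits a' → bits a' ⊆ bits c.stem ∪ c.res →
      ∀ y, question p u W n a' (Nat.pair x y)

/-- The condition forces `x ∈ coproj^[n] (PrimQuery u W G)`. -/
def ForcesMem (u : ℕ → ℕ) (W : Set ℕ) : ℕ → MathiasCond p → ℕ → Prop
  | 0, c, x => (∀ i < u x, i ∈ c.res → i ∈ bits c.stem) ∧ question p u W 0 c.stem x
  | n + 1, c, x => ∃ y, ForcesNotMem u W n c (Nat.pair x y)

/-- At a successor level the question can be tested on the reservoir itself, which belongs to `p`.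
-/
theorem ForcesNotMem.not_question {n : ℕ} {c : MathiasCond p} {x : ℕ}
    (h : ForcesNotMem u W n c x) : ¬ question p u W n c.stem x := by
  cases n with
  | zero => exact h.2
  | succ n =>
    intro hq
    obtain ⟨a', h1, h2, y, hy⟩ := hq _ c.res_mem
    exact hy (h a' h1 h2 y)

theorem Ext.use {c d : MathiasCond p} (hcd : c.Ext d) {m : ℕ}
    (h : ∀ i < m, i ∈ c.res → i ∈ bits c.stem) :
    (∀ i < m, i ∈ d.res → i ∈ bits d.stem) ∧ d.stem % 2 ^ m = c.stem % 2 ^ m := by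
  refine ⟨fun i hi hid => hcd.1 (h i hi (hcd.2.2 hid)), ?_⟩
  rw [← seg_bits, ← seg_bits]
  exact seg_congr fun i hi => ⟨fun hid => (hcd.2.1 hid).elim id (h i hi), fun hic => hcd.1 hic⟩

theorem ForcesNotMem.mono {n : ℕ} {c d : MathiasCond p} {x : ℕ} (hcd : c.Ext d)
    (h : ForcesNotMem u W n c x) : ForcesNotMem u W n d x := by
  cases n with
  | zero =>
    obtain ⟨h1, h2⟩ := hcd.use h.1
    exact ⟨h1, by simpa only [question, h2] using h.2⟩
  | succ n =>
    intro a' h1 h2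
    refine h a' (hcd.1.trans h1) (h2.trans ?_)
    exact Set.union_subset hcd.2.1 (hcd.2.2.trans Set.subset_union_right)

theorem exists_use (hp : ∀ Y ∈ p, Y.Infinite) (c : MathiasCond p) (m : ℕ) :
    ∃ d : MathiasCond p, c.Ext d ∧ d.stem = c.stem ∧ ∀ i < m, i ∈ d.res → i ∈ bits d.stem := by
  have hm : {i | i < m}ᶜ ∈ p := Ultrafilter.compl_mem_iff_notMem.2 fun h =>
    hp _ h (Set.finite_lt_nat m)
  refine ⟨⟨c.stem, c.res ∩ {i | i < m}ᶜ, Filter.inter_mem c.res_mem hm⟩,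
    ⟨subset_rfl, Set.subset_union_left, Set.inter_subset_left⟩, rfl, fun i hi h => ?_⟩
  exact absurd hi h.2

/-- At a successor level, a positive answer tested on the reservoir supplies a new stem and a `y`
for the induction. A negative answer supplies a `Y ∈ p` without counterexamples, and shrinking the
reservoir into `Y` suffices. -/
theorem exists_forces (hp : ∀ Y ∈ p, Y.Infinite) (n : ℕ) (c : MathiasCond p) (x : ℕ) :
    (question p u W n c.stem x → ∃ d, c.Ext d ∧ ForcesMem u W n d x) ∧
      (¬ question p u W n c.stem x → ∃ d, c.Ext d ∧ ForcesNotMem u W n d x) := by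
  induction n generalizing c x with
  | zero =>
    obtain ⟨d, hcd, hd, hu⟩ := c.exists_use hp (u x)
    exact ⟨fun h => ⟨d, hcd, hu, hd ▸ h⟩, fun h => ⟨d, hcd, hu, hd ▸ h⟩⟩
  | succ n ih =>
    constructor
    · intro h
      obtain ⟨a', h1, h2, y, hy⟩ := h _ c.res_mem
      obtain ⟨d, hd, hdn⟩ := (ih ⟨a', c.res, c.res_mem⟩ (Nat.pair x y)).2 hy
      exact ⟨d, Ext.trans (d := ⟨a', c.res, c.res_mem⟩) ⟨h1, h2, subset_rfl⟩ hd, y, hdn⟩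
    · intro h
      simp only [question, not_forall] at h
      obtain ⟨Y, hY, hYx⟩ := h
      refine ⟨⟨c.stem, c.res ∩ Y, Filter.inter_mem c.res_mem hY⟩,
        ⟨subset_rfl, Set.subset_union_left, Set.inter_subset_left⟩, fun a' h1 h2 y => ?_⟩
      by_contra hq
      exact hYx ⟨a', h1, h2.trans (Set.union_subset_union_right _ Set.inter_subset_right), y, hq⟩

/-- The generic set of a sequence of conditions. -/
def generic (s : ℕ → MathiasCond p) : Set ℕ := ⋃ n, bits (s n).stem

theorem seg_generic {s : ℕ → MathiasCond p} (hs : ∀ m n, m ≤ n → (s m).Ext (s n)) {k m : ℕ}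
    (h : ∀ i < m, i ∈ (s k).res → i ∈ bits (s k).stem) :
    seg (generic s) m = (s k).stem % 2 ^ m := by
  rw [← seg_bits]
  refine seg_congr fun i hi => ⟨fun hid => ?_, fun hid => Set.mem_iUnion.2 ⟨k, hid⟩⟩
  obtain ⟨n, hn⟩ := Set.mem_iUnion.1 hid
  have := (hs n (max n k) (le_max_left _ _)).1 hn
  exact ((hs k (max n k) (le_max_right _ _)).2.1 this).elim id (h i hi)

theorem truth {s : ℕ → MathiasCond p} (hs : ∀ m n, m ≤ n → (s m).Ext (s n))
    (hdec : ∀ n x, ∃ k, ForcesMem u W n (s k) x ∨ ForcesNotMem u W n (s k) x) (n k x : ℕ) :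
    (ForcesMem u W n (s k) x → x ∈ coproj^[n] (PrimQuery u W (generic s))) ∧
      (ForcesNotMem u W n (s k) x → x ∉ coproj^[n] (PrimQuery u W (generic s))) := by
  induction n generalizing k x with
  | zero =>
    constructor
    · rintro ⟨h1, h2⟩
      simpa [PrimQuery, seg_generic hs h1, question] using h2
    · rintro ⟨h1, h2⟩
      simpa [PrimQuery, seg_generic hs h1, question] using h2
  | succ n ih =>
    rw [Function.iterate_succ_apply']
    constructor
    · rintro ⟨y, hy⟩
      exact ⟨y, (ih k _).2 hy⟩
    · rintro h ⟨y, hy⟩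
      obtain ⟨j, hj | hj⟩ := hdec n (Nat.pair x y)
      · exact hy ((ih j _).1 hj)
      -- At a common extension, the lower-level decision refutes a question that the condition at
      -- `k` affirms for all stems extending its own.
      · have hkj := hs k (max j k) (le_max_right _ _)
        exact (hj.mono (hs j (max j k) (le_max_left _ _))).not_question
          (h _ hkj.1 hkj.2.1 y)

theorem exists_mem_gt (hp : ∀ Y ∈ p, Y.Infinite) (c : MathiasCond p) (m : ℕ) :
    ∃ d, c.Ext d ∧ ∃ i ∈ bits d.stem, m < i := by
  obtain ⟨i, hi, hmi⟩ := (hp _ c.res_mem).exists_gt m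
  obtain ⟨a, ha⟩ := exists_bits_eq ((bits_finite c.stem).insert i)
  refine ⟨⟨a, c.res, c.res_mem⟩, ⟨?_, ?_, subset_rfl⟩, i, by simp [ha], hmi⟩
  · simp [ha]
  · simp only [ha]
    exact Set.insert_subset (.inr hi) Set.subset_union_left

/-- If the answers at the current stem agreed with `B` everywhere, they would define `B`
arithmetically. At a disagreement, the answer is forced. -/
theorem exists_diagonal (hp : ∀ Y ∈ p, Y.Infinite) {B : Set ℕ} (hB : ¬ Arithmetical B) {n : ℕ}
    (hq : ArithDef ∅ fun q : ℕ × ℕ => question p u W n q.1 q.2) (c : MathiasCond p) :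
    ∃ d, c.Ext d ∧ ∃ x, (x ∈ B ∧ ForcesNotMem u W n d x) ∨ (x ∉ B ∧ ForcesMem u W n d x) := by
  have : ∃ x, ¬ (x ∈ B ↔ question p u W n c.stem x) := by
    by_contra! h
    exact hB (((hq.comp (f := fun x => (c.stem, x)) (by fun_prop)).of_iff h).arithmetical)
  obtain ⟨x, hx⟩ := this
  by_cases hxB : x ∈ B
  · obtain ⟨d, hcd, hd⟩ := (c.exists_forces hp n x).2 fun h => hx ⟨fun _ => h, fun _ => hxB⟩
    exact ⟨d, hcd, x, .inl ⟨hxB, hd⟩⟩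
  · obtain ⟨d, hcd, hd⟩ := (c.exists_forces hp n x).1
      (by_contra fun h => hx ⟨fun h' => absurd h' hxB, fun h' => absurd h' h⟩)
    exact ⟨d, hcd, x, .inr ⟨hxB, hd⟩⟩

end MathiasCond

/-! ### The generic set and the theorem. -/

open MathiasCond in
theorem exists_infinite_subset_not_arithmeticalIn {p : Ultrafilter ℕ} (hp : ∀ Y ∈ p, Y.Infinite)
    (hq : ∀ u W, Primrec u → PrimrecPred (· ∈ W) →
      ∀ n, ArithDef ∅ fun q : ℕ × ℕ => question p u W n q.1 q.2)
    {B : Set ℕ} (hB : ¬ Arithmetical B) {A : Set ℕ} (hA : A ∈ p) :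
    ∃ H ⊆ A, H.Infinite ∧ ¬ ArithmeticalIn H B := by
  have := countable_primrec
  have := countable_primrecPred
  let J := {u : ℕ → ℕ // Primrec u} × {W : Set ℕ // PrimrecPred (· ∈ W)}
  -- The three families make the generic infinite, separate `B` from each set of the hierarchy, and
  -- decide every membership, as the truth lemma requires.
  let D : ℕ ⊕ (J × ℕ) ⊕ (J × ℕ × ℕ) → MathiasCond p → Prop
    | .inl m, d => ∃ i ∈ bits d.stem, m < i
    | .inr (.inl (j, n)), d => ∃ x, (x ∈ B ∧ ForcesNotMem j.1.1 j.2.1 n d x) ∨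
        (x ∉ B ∧ ForcesMem j.1.1 j.2.1 n d x)
    | .inr (.inr (j, n, x)), d => ForcesMem j.1.1 j.2.1 n d x ∨ ForcesNotMem j.1.1 j.2.1 n d x
  have hD : ∀ i c, ∃ d, Ext c d ∧ D i d := by
    rintro (m | ⟨j, n⟩ | ⟨j, n, x⟩) c
    · exact c.exists_mem_gt hp m
    · exact c.exists_diagonal hp hB (hq _ _ j.1.2 j.2.2 n)
    · by_cases h : question p j.1.1 j.2.1 n c.stem x
      · obtain ⟨d, hcd, hd⟩ := (c.exists_forces hp n x).1 h
        exact ⟨d, hcd, .inl hd⟩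
      · obtain ⟨d, hcd, hd⟩ := (c.exists_forces hp n x).2 h
        exact ⟨d, hcd, .inr hd⟩
  obtain ⟨s, hs0, hs, hsD⟩ := exists_chain_meeting (r := Ext) Ext.refl
    (fun _ _ _ h h' => h.trans h') (⟨0, A, hA⟩ : MathiasCond p) hD
  refine ⟨generic s, ?_, ?_, ?_⟩
  · refine Set.iUnion_subset fun n => ?_
    have := (hs 0 n n.zero_le).2.1
    rw [hs0] at this
    simpa [bits] using this
  · refine Set.infinite_of_forall_exists_gt fun m => ?_
    obtain ⟨k, i, hi, hmi⟩ := hsD (.inl m)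
    exact ⟨i, Set.mem_iUnion.2 ⟨k, hi⟩, hmi⟩
  · rintro ⟨l, hl⟩
    obtain ⟨n, S, ⟨u, W, hu, hW, rfl⟩, hS⟩ := ArithDef.of_sigmaZero hl
    obtain ⟨k, x, hx⟩ := hsD (.inr (.inl ((⟨u, hu⟩, ⟨W, hW⟩), n)))
    have htruth := truth hs (fun n x => hsD (.inr (.inr ((⟨u, hu⟩, ⟨W, hW⟩), n, x)))) n k x
    rcases hx with ⟨hxB, hx⟩ | ⟨hxB, hx⟩
    · exact htruth.2 hx ((hS x).1 hxB)
    · exact hxB ((hS x).2 (htruth.1 hx))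

theorem theorem2 (B : Set ℕ) (hB : ¬ Arithmetical B) (A : Set ℕ) :
    ∃ H : Set ℕ, H.Infinite ∧ (H ⊆ A ∨ H ⊆ Aᶜ) ∧ ¬ ArithmeticalIn H B := by
  obtain ⟨p, hp, hq⟩ := exists_ultrafilter_arithDef_question
  rcases p.mem_or_compl_mem A with hA | hA
  · obtain ⟨H, hHA, hH, hHB⟩ := exists_infinite_subset_not_arithmeticalIn hp hq hB hA
    exact ⟨H, hH, .inl hHA, hHB⟩
  · obtain ⟨H, hHA, hH, hHB⟩ := exists_infinite_subset_not_arithmeticalIn hp hq hB hA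
    exact ⟨H, hH, .inr hHA, hHB⟩
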